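/- A strict category is a small category in which objects may be compared for equality; all sets below belong to one fixed universe. Definitions. **Stratification.** Let $\mathcal C$ be a strict category with a chosen terminal object $1$. A stratification of $\mathcal C$ is a functor $L:\mathcal C\to(\mathbb N,\ge)$ such that (1) $L(X)=0$ iff $X=1$; (2) for $f:X\to Y$, $L(X)=L(Y)$ iff $X=Y$ and $f=\mathrm{id}_X$; (3) every $f:X\to Y$ with $L(X)=n+m+1$, $L(Y)=n$ has a unique factorization $X=X_{m+1}\to X_m\to\cdots\to X_0=Y$ with $L(X_i)=n+i$. (There is at most one.) It induces on the slice $\mathcal C/X$ the stratification $L_X(f:Y\to X)=L(Y)-L(X)$. A functor $F:\mathcal C\to\mathcal D$ between stratified categories is stratified if $L_{\mathcal C}=L_{\mathcal D}\circ F$. **C-systems.** A C-system consists of a strict category $\mathcal C$, a function $\ell:\mathrm{Ob}(\mathcal C)\to\mathbb N$, an object $1$, a function $\mathrm{ft}:\mathrm{Ob}(\mathcal C)\to\mathrm{Ob}(\mathcal C)$, for each $\Gamma$ with $\ell(\Gamma)>0$ an arrow $p_\Gamma:\Gamma\to\mathrm{ft}(\Gamma)$, and for each $\Gamma$ with $\ell(\Gamma)>0$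 and $f:\Delta\to\mathrm{ft}(\Gamma)$ an object $f^*\Gamma$ and an arrow $q(f,\Gamma):f^*\Gamma\to\Gamma$, such that: $\ell^{-1}(0)=\{1\}$; $\ell(\mathrm{ft}(\Gamma))=\ell(\Gamma)-1$ if $\ell(\Gamma)>0$; $\mathrm{ft}(1)=1$; $1$ is terminal; and, for $\Gamma$ with $\ell(\Gamma)>0$ and $f:\Delta\to\mathrm{ft}(\Gamma)$, $\ell(f^*\Gamma)>0$, $\mathrm{ft}(f^*\Gamma)=\Delta$ and the square $p_\Gamma\circ q(f,\Gamma)=f\circ p_{f^*\Gamma}$ commutes and is a pullback; $\mathrm{id}^*\Gamma=\Gamma$, $q(\mathrm{id},\Gamma)=\mathrm{id}_\Gamma$; $(g\circ f)^*\Gamma=f^*g^*\Gamma$ and $q(g\circ f,\Gamma)=q(g,\Gamma)\circ q(f,g^*\Gamma)$. A morphism of C-systems is a functor strictly preserving $1,\ell,\mathrm{ft},p,f^*\Gamma$ and $q$. This gives the category $\mathbf{Csys}$. **CE-systems.** A CE-system consists of two strict category structures $\mathcal F,\mathcal C$ on the same set of objects, an identity-on-objects functor $I:\mathcal F\to\mathcal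 C$, a chosen object $1$ which is terminal in $\mathcal F$, and, for every $f:\Delta\to\Gamma$ in $\mathcal C$ and every $A:\Gamma.A\to\Gamma$ in $\mathcal F/\Gamma$, a family $f^*A:\Delta.f^*A\to\Delta$ in $\mathcal F/\Delta$ and an arrow $\pi_2(f,A):\Delta.f^*A\to\Gamma.A$ in $\mathcal C$ such that $I(A)\circ\pi_2(f,A)=f\circ I(f^*A)$ is a pullback square in $\mathcal C$ and (a) $f^*\mathrm{id}_\Gamma=\mathrm{id}_\Delta$, $\pi_2(f,\mathrm{id}_\Gamma)=f$; (b) $\mathrm{id}_\Gamma^*A=A$, $\pi_2(\mathrm{id}_\Gamma,A)=\mathrm{id}_{\Gamma.A}$; (c) $(f\circ g)^*A=g^*(f^*A)$, $\pi_2(f\circ g,A)=\pi_2(f,A)\circ\pi_2(g,f^*A)$; (d) $f^*(A\circ P)=f^*A\circ\pi_2(f,A)^*P$, $\pi_2(f,A\circ P)=\pi_2(\pi_2(f,A),P)$ for $P\in\mathcal F/\Gamma.A$. It is rooted if $1$ is also terminal in $\mathcal C$. It is stratified if $\mathcal F$ is stratified and every functor $f^*:\mathcal F/\Gamma\to\mathcal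 F/\Delta$ is stratified for the induced stratifications of the slices. A CE-homomorphism $(F_{\mathcal F},F_{\mathcal C})$ is a pair of functors with $F_{\mathcal C}\circ I=I\circ F_{\mathcal F}$ which preserves the chosen object, the families $f^*A$ and the arrows $\pi_2(f,A)$; between stratified CE-systems it is stratified if $F_{\mathcal F}$ is. Let $\mathbf{rCEsys}_s$ be the category of stratified rooted CE-systems and stratified CE-homomorphisms. **The functor $\mathrm{CE}$.** For a C-system with underlying category $\mathcal C$, let $\mathcal F$ be the free category on the wide subgraph of $\mathcal C$ whose edges are the canonical projections $p_\Gamma$, and let $I:\mathcal F\to\mathcal C$ send a path to its composite. The chosen object is $1$. Pullbacks are defined by induction on the length of a path: $f^*\mathrm{id}_\Gamma=\mathrm{id}_\Delta$, $\pi_2(f,\mathrm{id}_\Gamma)=f$; and for a path $a=a'\circ p_\Xi$ from $\Xi$ to $\Gamma$ one sets $\pi_2(f,a)=q(\pi_2(f,a'),\Xi)$ and $f^*a=f^*a'\circ p_{\pi_2(f,a')^*\Xi}$. This is a stratified rooted CE-system with $L=\ell$. A morphism $F$ of C-systems is sent to $(F_{\mathcal F},F)$, where $F_{\mathcal F}$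 is induced by the action of $F$ on canonical projections. **Theorem.** The functor $\mathrm{CE}:\mathbf{Csys}\to\mathbf{rCEsys}_s$ is an equivalence of categories. -/

import Mathlib

open CategoryTheory CategoryTheory.Limits

universe u

-- `X ⟶ Y` in a category refers to the quiver structure of that category, and is not found through
-- the associated reflexive quiver.
attribute [instance 2000] CategoryTheory.CategoryStruct.toQuiver

/-! ### Arrows picked out by a wide subgraph -/

/-- The inclusion of a wide subgraph of a (multi)graph. -/
def WideSubquiver.inclusion {V : Type*} [Quiver V] (H : WideSubquiver V) : H ⥤q V where
  obj X := X
  map e := e.1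

/-- The composite, in a category, of a path in a wide subgraph of the category. -/
def WideSubquiver.composite {C : Type*} [Category C] (H : WideSubquiver C) {X Y : H}
    (a : Quiver.Path X Y) :
    @Quiver.Hom C _ (H.inclusion.obj X) (H.inclusion.obj Y) :=
  composePath (H.inclusion.mapPath a)

/-! ### Stratifications -/

/-- The wide subgraph on the individual arrows, with respect to a length function. -/
def individualArrows {C : Type*} [Category C] (L : C → ℕ) : WideSubquiver C :=
  fun X Y => {_f : X ⟶ Y | L X = L Y + 1}

/-- A stratification of a strict category `C` with chosen terminal object `one`.
A category has at most one stratification.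
The functor `L : C ⥤ (ℕ, ≥)` is given by its action on objects; on arrows it amounts to `anti`. -/
structure Stratification (C : Type*) [Category C] (one : C) where
  /-- the length of an object -/
  L : C → ℕ
  anti : ∀ {X Y : C}, (X ⟶ Y) → L X ≥ L Y
  eq_zero_iff : ∀ X : C, L X = 0 ↔ X = one
  eq_iff : ∀ {X Y : C} (f : X ⟶ Y), L X = L Y ↔ ∃ h : X = Y, f = eqToHom h
  /-- Every arrow which strictly decreases the length is, in a unique way, the composite of a
  path of arrows each of which decreases the length by exactly one. -/
  factor : ∀ {X Y : C} (f : X ⟶ Y), L Y < L X →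
    ∃! a : @Quiver.Path (individualArrows L) _ X Y, (individualArrows L).composite a = f

/-- The length function of the stratification induced on the slice over `X`. -/
def Stratification.slice {C : Type*} [Category C] {one : C} (S : Stratification C one) {X : C}
    (A : Over X) : ℕ :=
  S.L A.left - S.L X

/-! ### C-systems -/

/-- A C-system. Equations between arrows whose endpoints agree only by an equation between objects
are expressed by `eqToHom` or by heterogeneous equality. -/
structure CSystem where
  /-- the objects of the underlying strict category -/
  Ob : Type u
  [category : SmallCategory Ob]
  /-- the length function -/
  len : Ob → ℕ
  /-- the chosen object -/
  one : Ob
  /-- the father function -/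
  ft : Ob → Ob
  /-- the canonical projections -/
  p (Γ : Ob) (h : 0 < len Γ) : Γ ⟶ ft Γ
  /-- the object `f^* Γ` -/
  pb {Γ Δ : Ob} (h : 0 < len Γ) (f : Δ ⟶ ft Γ) : Ob
  /-- the arrow `q(f, Γ)` -/
  q {Γ Δ : Ob} (h : 0 < len Γ) (f : Δ ⟶ ft Γ) : pb h f ⟶ Γ
  len_eq_zero_iff : ∀ Γ, len Γ = 0 ↔ Γ = one
  len_ft : ∀ Γ, 0 < len Γ → len (ft Γ) = len Γ - 1
  ft_one : ft one = one
  one_terminal : Nonempty (IsTerminal one)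
  len_pb : ∀ {Γ Δ : Ob} (h : 0 < len Γ) (f : Δ ⟶ ft Γ), 0 < len (pb h f)
  ft_pb : ∀ {Γ Δ : Ob} (h : 0 < len Γ) (f : Δ ⟶ ft Γ), ft (pb h f) = Δ
  isPullback : ∀ {Γ Δ : Ob} (h : 0 < len Γ) (f : Δ ⟶ ft Γ),
    IsPullback (q h f) (p (pb h f) (len_pb h f) ≫ eqToHom (ft_pb h f)) (p Γ h) f
  pb_id : ∀ {Γ : Ob} (h : 0 < len Γ), pb h (𝟙 (ft Γ)) = Γ
  q_id : ∀ {Γ : Ob} (h : 0 < len Γ), q h (𝟙 (ft Γ)) ≍ 𝟙 Γ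
  pb_comp : ∀ {Γ Δ Ε : Ob} (h : 0 < len Γ) (g : Δ ⟶ ft Γ) (f : Ε ⟶ Δ),
    pb h (f ≫ g) = pb (len_pb h g) (f ≫ eqToHom (ft_pb h g).symm)
  q_comp : ∀ {Γ Δ Ε : Ob} (h : 0 < len Γ) (g : Δ ⟶ ft Γ) (f : Ε ⟶ Δ),
    q h (f ≫ g) ≍ q (len_pb h g) (f ≫ eqToHom (ft_pb h g).symm) ≫ q h g

namespace CSystem

attribute [instance] CSystem.category

theorem pb_congr (C : CSystem.{u}) {Γ Γ' Δ Δ' : C.Ob} (h : 0 < C.len Γ) (h' : 0 < C.len Γ')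
    (f : Δ ⟶ C.ft Γ) (f' : Δ' ⟶ C.ft Γ') (hΓ : Γ = Γ') (hΔ : Δ = Δ') (hf : f ≍ f') :
    C.pb h f = C.pb h' f' := by
  subst hΓ hΔ; cases hf; rfl

theorem q_congr (C : CSystem.{u}) {Γ Γ' Δ Δ' : C.Ob} (h : 0 < C.len Γ) (h' : 0 < C.len Γ')
    (f : Δ ⟶ C.ft Γ) (f' : Δ' ⟶ C.ft Γ') (hΓ : Γ = Γ') (hΔ : Δ = Δ') (hf : f ≍ f') :
    C.q h f ≍ C.q h' f' := by
  subst hΓ hΔ; cases hf; rfl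

theorem p_congr (C : CSystem.{u}) {Γ Γ' : C.Ob} (h : 0 < C.len Γ) (h' : 0 < C.len Γ')
    (hΓ : Γ = Γ') : C.p Γ h ≍ C.p Γ' h' := by
  subst hΓ; rfl

end CSystem

theorem functor_map_heq {C D : Type*} [Category C] [Category D] (F : C ⥤ D) {X Y X' Y' : C}
    {f : X ⟶ Y} {f' : X' ⟶ Y'} (hX : X = X') (hY : Y = Y') (h : f ≍ f') :
    F.map f ≍ F.map f' := by
  subst hX hY; cases h; rfl

/-- A morphism of C-systems. -/
structure CSystem.Hom (C D : CSystem.{u}) where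
  /-- the underlying functor -/
  functor : C.Ob ⥤ D.Ob
  map_one : functor.obj C.one = D.one
  map_len : ∀ Γ, D.len (functor.obj Γ) = C.len Γ
  map_ft : ∀ Γ, functor.obj (C.ft Γ) = D.ft (functor.obj Γ)
  map_p : ∀ Γ (h : 0 < C.len Γ),
    functor.map (C.p Γ h) ≍ D.p (functor.obj Γ) ((map_len Γ).symm ▸ h)
  map_pb : ∀ {Γ Δ : C.Ob} (h : 0 < C.len Γ) (f : Δ ⟶ C.ft Γ),
    functor.obj (C.pb h f) =
      D.pb ((map_len Γ).symm ▸ h) (functor.map f ≫ eqToHom (map_ft Γ))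
  map_q : ∀ {Γ Δ : C.Ob} (h : 0 < C.len Γ) (f : Δ ⟶ C.ft Γ),
    functor.map (C.q h f) ≍
      D.q ((map_len Γ).symm ▸ h) (functor.map f ≫ eqToHom (map_ft Γ))

namespace CSystem

@[ext]
theorem Hom.ext {C D : CSystem.{u}} {F G : Hom C D} (h : F.functor = G.functor) : F = G := by
  cases F; cases G; cases h; rfl

/-- The identity morphism of a C-system. -/
def Hom.id (C : CSystem.{u}) : Hom C C where
  functor := 𝟭 C.Ob
  map_one := rfl
  map_len _ := rfl
  map_ft _ := rfl
  map_p _ _ := HEq.rfl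
  map_pb h f := C.pb_congr _ _ _ _ rfl rfl (by simp)
  map_q h f := C.q_congr _ _ _ _ rfl rfl (by simp)

/-- Composition of morphisms of C-systems. -/
def Hom.comp {C D E : CSystem.{u}} (F : Hom C D) (G : Hom D E) : Hom C E where
  functor := F.functor ⋙ G.functor
  map_one := (congrArg G.functor.obj F.map_one).trans G.map_one
  map_len Γ := (G.map_len _).trans (F.map_len Γ)
  map_ft Γ := (congrArg G.functor.obj (F.map_ft Γ)).trans (G.map_ft _)
  map_p Γ h := (functor_map_heq G.functor rfl (F.map_ft Γ) (F.map_p Γ h)).trans (G.map_p _ _)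
  map_pb {Γ Δ} h f := by
    refine (congrArg G.functor.obj (F.map_pb h f)).trans ((G.map_pb _ _).trans ?_)
    refine E.pb_congr _ _ _ _ rfl rfl ?_
    simp [eqToHom_map]
  map_q {Γ Δ} h f := by
    refine (functor_map_heq G.functor (F.map_pb h f) rfl (F.map_q h f)).trans
      ((G.map_q _ _).trans ?_)
    refine E.q_congr _ _ _ _ rfl rfl ?_
    simp [eqToHom_map]

/-- The category of C-systems. -/
instance : Category CSystem.{u} where
  Hom := Hom
  id := Hom.id
  comp := Hom.comp

end CSystem

/-! ### CE-systems -/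

/-- Two strict category structures, on the same set of objects, and an identity-on-objects
functor from the first (families) to the second. -/
structure CEBase where
  /-- the common set of objects -/
  Ob : Type u
  /-- the category structure of families -/
  famCategory : SmallCategory Ob
  [category : SmallCategory Ob]
  /-- the action on arrows of the identity-on-objects functor `I` -/
  I {X Y : Ob} (a : @Quiver.Hom Ob famCategory.toQuiver X Y) : X ⟶ Y
  I_id : ∀ X : Ob, I (famCategory.id X) = 𝟙 X
  I_comp : ∀ {X Y Z : Ob} (a : @Quiver.Hom Ob famCategory.toQuiver X Y)
    (b : @Quiver.Hom Ob famCategory.toQuiver Y Z), I (famCategory.comp a b) = I a ≫ I b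

namespace CEBase

attribute [instance] CEBase.category

/-- The strict category of families: same objects, with the family arrows. -/
def Fam (A : CEBase.{u}) : Type u := A.Ob

instance (A : CEBase.{u}) : SmallCategory A.Fam := A.famCategory

/-- The slice of the category of families over `Γ`. -/
abbrev Slice (A : CEBase.{u}) (Γ : A.Ob) : Type u := @Over A.Fam _ Γ

/-- The identity family on `Γ`, as an object of the slice. -/
abbrev idFam (A : CEBase.{u}) (Γ : A.Ob) : A.Slice Γ := Over.mk (@CategoryStruct.id A.Fam _ Γ)

/-- The domain of a family over `Γ`. -/
abbrev ext (A : CEBase.{u}) {Γ : A.Ob} (X : A.Slice Γ) : A.Ob := X.left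

/-- The family `X ∘ P` over `Γ`, for a family `X` over `Γ` and a family `P` over its domain. -/
abbrev compFam (A : CEBase.{u}) {Γ : A.Ob} (X : A.Slice Γ) (P : A.Slice (A.ext X)) : A.Slice Γ :=
  Over.mk (P.hom ≫ X.hom)

end CEBase

/-- A CE-system: `pb f A` is the family `f^* A` in the slice of the category of families, and
`π₂ f A` is the top arrow of the chosen pullback square. -/
structure CESystem extends CEBase.{u} where
  /-- the chosen object -/
  root : Ob
  root_terminal : Nonempty (@IsTerminal toCEBase.Fam _ root)
  /-- the family `f^* A` -/
  pb {Γ Δ : Ob} (f : Δ ⟶ Γ) (A : toCEBase.Slice Γ) : toCEBase.Slice Δ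
  /-- the arrow `π₂(f, A)` -/
  π₂ {Γ Δ : Ob} (f : Δ ⟶ Γ) (A : toCEBase.Slice Γ) :
    toCEBase.ext (pb f A) ⟶ toCEBase.ext A
  isPullback : ∀ {Γ Δ : Ob} (f : Δ ⟶ Γ) (A : toCEBase.Slice Γ),
    IsPullback (π₂ f A) (I (pb f A).hom) (I A.hom) f
  pb_idFam : ∀ {Γ Δ : Ob} (f : Δ ⟶ Γ), pb f (toCEBase.idFam Γ) = toCEBase.idFam Δ
  π₂_idFam : ∀ {Γ Δ : Ob} (f : Δ ⟶ Γ), π₂ f (toCEBase.idFam Γ) ≍ f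
  pb_id : ∀ {Γ : Ob} (A : toCEBase.Slice Γ), pb (𝟙 Γ) A = A
  π₂_id : ∀ {Γ : Ob} (A : toCEBase.Slice Γ), π₂ (𝟙 Γ) A ≍ 𝟙 (toCEBase.ext A)
  pb_comp : ∀ {Γ Δ Ξ : Ob} (f : Δ ⟶ Γ) (g : Ξ ⟶ Δ) (A : toCEBase.Slice Γ),
    pb (g ≫ f) A = pb g (pb f A)
  π₂_comp : ∀ {Γ Δ Ξ : Ob} (f : Δ ⟶ Γ) (g : Ξ ⟶ Δ) (A : toCEBase.Slice Γ),
    π₂ (g ≫ f) A ≍ π₂ g (pb f A) ≫ π₂ f A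
  pb_compFam : ∀ {Γ Δ : Ob} (f : Δ ⟶ Γ) (A : toCEBase.Slice Γ)
    (P : toCEBase.Slice (toCEBase.ext A)),
    pb f (toCEBase.compFam A P) = toCEBase.compFam (pb f A) (pb (π₂ f A) P)
  π₂_compFam : ∀ {Γ Δ : Ob} (f : Δ ⟶ Γ) (A : toCEBase.Slice Γ)
    (P : toCEBase.Slice (toCEBase.ext A)),
    π₂ f (toCEBase.compFam A P) ≍ π₂ (π₂ f A) P

namespace CESystem

/-- A CE-homomorphism. Since the functors `I` of `A` and `B` are identities on objects, a commutative
square of functors consists of a functor `ctx` between the second categories and a functor between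
the categories of families with the same action on objects, such that `comm` holds. -/
structure Hom (A B : CESystem.{u}) where
  /-- the functor between the second categories -/
  ctx : A.Ob ⥤ B.Ob
  /-- the action on arrows of the functor between the categories of families -/
  fam {X Y : A.Fam} (a : X ⟶ Y) : @Quiver.Hom B.Fam _ (ctx.obj X) (ctx.obj Y)
  fam_id : ∀ X : A.Fam, fam (𝟙 X) = @CategoryStruct.id B.Fam _ (ctx.obj X)
  fam_comp : ∀ {X Y Z : A.Fam} (a : X ⟶ Y) (b : Y ⟶ Z), fam (a ≫ b) = fam a ≫ fam b
  comm : ∀ {X Y : A.Fam} (a : X ⟶ Y), ctx.map (A.I a) = B.I (fam a)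
  map_root : ctx.obj A.root = B.root
  map_pb : ∀ {Γ Δ : A.Ob} (f : Δ ⟶ Γ) (X : A.Slice Γ),
    Over.mk (fam (A.pb f X).hom) = B.pb (ctx.map f) (Over.mk (fam X.hom))
  map_π₂ : ∀ {Γ Δ : A.Ob} (f : Δ ⟶ Γ) (X : A.Slice Γ),
    ctx.map (A.π₂ f X) ≍ B.π₂ (ctx.map f) (Over.mk (fam X.hom))

theorem Hom.ext {A B : CESystem.{u}} {F G : Hom A B} (h : F.ctx = G.ctx)
    (h' : ∀ {X Y : A.Fam} (a : X ⟶ Y), F.fam a ≍ G.fam a) : F = G := by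
  obtain ⟨F, Ff, _, _, _, _, _, _⟩ := F
  obtain ⟨G, Gf, _, _, _, _, _, _⟩ := G
  subst h
  have : @Ff = @Gf := by
    funext X Y a
    exact eq_of_heq (h' a)
  subst this
  rfl

/-- The identity CE-homomorphism. -/
def Hom.id (A : CESystem.{u}) : Hom A A where
  ctx := 𝟭 A.Ob
  fam a := a
  fam_id _ := rfl
  fam_comp _ _ := rfl
  comm _ := rfl
  map_root := rfl
  map_pb _ _ := rfl
  map_π₂ _ _ := HEq.rfl

/-- Composition of CE-homomorphisms. -/
def Hom.comp {A B C : CESystem.{u}} (F : Hom A B) (G : Hom B C) : Hom A C where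
  ctx := F.ctx ⋙ G.ctx
  fam a := G.fam (F.fam a)
  fam_id X := (congrArg G.fam (F.fam_id X)).trans (G.fam_id _)
  fam_comp a b := (congrArg G.fam (F.fam_comp a b)).trans (G.fam_comp _ _)
  comm a := (congrArg G.ctx.map (F.comm a)).trans (G.comm _)
  map_root := (congrArg G.ctx.obj F.map_root).trans G.map_root
  map_pb {_ Δ} f X :=
    (congrArg (fun Y : B.Slice (F.ctx.obj Δ) =>
      (Over.mk (G.fam Y.hom) : C.Slice (G.ctx.obj (F.ctx.obj Δ)))) (F.map_pb f X)).trans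
      (G.map_pb _ _)
  map_π₂ f X :=
    (functor_map_heq G.ctx (congrArg B.ext (F.map_pb f X)) rfl (F.map_π₂ f X)).trans
      (G.map_π₂ _ _)

/-- The category of CE-systems. -/
instance : Category CESystem.{u} where
  Hom := Hom
  id := Hom.id
  comp := Hom.comp

/-- A CE-system is rooted if the chosen object is terminal in the second category as well. -/
def IsRooted (A : CESystem.{u}) : Prop := Nonempty (IsTerminal A.root)

end CESystem

/-- A stratified rooted CE-system. -/
structure StratifiedRootedCESystem extends CESystem.{u} where
  rooted : toCESystem.IsRooted
  /-- the stratification of the category of families -/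
  strat : Stratification toCESystem.Fam root
  /-- the functors `f^*` between slices of the category of families are stratified -/
  pb_strat : ∀ {Γ Δ : Ob} (f : Δ ⟶ Γ) (A : toCESystem.Slice Γ),
    strat.slice (pb f A) = strat.slice A

namespace StratifiedRootedCESystem

/-- A CE-homomorphism between stratified rooted CE-systems is stratified if its component on
families is a stratified functor. -/
def IsStratifiedHom {A B : StratifiedRootedCESystem.{u}} (F : A.toCESystem ⟶ B.toCESystem) : Prop :=
  ∀ X : A.Fam, B.strat.L (F.ctx.obj X) = A.strat.L X

/-- The category of stratified rooted CE-systems and stratified CE-homomorphisms. -/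
instance : Category StratifiedRootedCESystem.{u} where
  Hom A B := {F : A.toCESystem ⟶ B.toCESystem // IsStratifiedHom F}
  id A := ⟨𝟙 A.toCESystem, fun _ => rfl⟩
  comp F G := ⟨F.1 ≫ G.1, fun X => (G.2 _).trans (F.2 X)⟩

end StratifiedRootedCESystem

/-! ### The functor from C-systems to stratified rooted CE-systems -/

/-- When each vertex is the source of at most one edge and edges decrease a length function by one,
paths are determined by their source and the length of their target. -/
theorem Quiver.Path.heq_of_length {V : Type*} [Quiver V] (L : V → ℕ)
    (hL : ∀ {X Y : V}, (X ⟶ Y) → L X = L Y + 1)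
    (hE : ∀ {X Y Y' : V} (e : X ⟶ Y) (e' : X ⟶ Y'), Y = Y' ∧ e ≍ e') {X Y : V}
    (a : Quiver.Path X Y) : ∀ {Y' : V} (b : Quiver.Path X Y'), L Y = L Y' → Y = Y' ∧ a ≍ b := by
  have len : ∀ {X Y : V} (a : Quiver.Path X Y), L Y ≤ L X := by
    intro X Y a
    induction a with
    | nil => exact le_rfl
    | cons a e ih => have := hL e; omega
  induction a with
  | nil =>
    intro Y' b h
    cases b with
    | nil => exact ⟨rfl, HEq.rfl⟩
    | cons b e =>
      have := len b
      have := hL e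
      omega
  | cons a e ih =>
    intro Y' b h
    cases b with
    | nil =>
      have := len a
      have := hL e
      omega
    | cons b e' =>
      have h1 := hL e
      have h2 := hL e'
      obtain ⟨h3, h4⟩ := ih b (by omega)
      subst h3
      cases h4
      obtain ⟨h5, h6⟩ := hE e e'
      subst h5
      cases h6
      exact ⟨rfl, HEq.rfl⟩

namespace CSystem

variable (C : CSystem.{u})

/-- An arrow is a canonical projection. -/
inductive IsProjection : ∀ {X Y : C.Ob}, (X ⟶ Y) → Prop
  | intro (Γ : C.Ob) (h : 0 < C.len Γ) : IsProjection (C.p Γ h)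

/-- The wide subgraph on the canonical projections. -/
def projections : WideSubquiver C.Ob := fun _ _ => {e | C.IsProjection e}

/-- The free category on the graph of canonical projections, as a category structure on the
objects of `C`. -/
@[reducible] def freeCategory : SmallCategory C.Ob := Paths.categoryPaths C.projections

variable {C}

theorem IsProjection.spec {X Y : C.Ob} {e : X ⟶ Y} (he : C.IsProjection e) :
    ∃ (h : 0 < C.len X) (hY : C.ft X = Y), e = C.p X h ≫ eqToHom hY := by
  cases he with
  | intro h => exact ⟨h, rfl, by simp⟩

theorem IsProjection.mk' {X Y : C.Ob} (h : 0 < C.len X) (hY : C.ft X = Y) :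
    C.IsProjection (C.p X h ≫ eqToHom hY) := by
  subst hY
  simpa using IsProjection.intro X h

theorem IsProjection.pos {X Y : C.Ob} {e : X ⟶ Y} (he : C.IsProjection e) : 0 < C.len X :=
  he.spec.1

theorem IsProjection.ft_eq {X Y : C.Ob} {e : X ⟶ Y} (he : C.IsProjection e) : C.ft X = Y :=
  he.spec.2.1

theorem IsProjection.len_eq {X Y : C.Ob} {e : X ⟶ Y} (he : C.IsProjection e) :
    C.len X = C.len Y + 1 := by
  have := C.len_ft X he.pos
  rw [he.ft_eq] at this
  have := he.pos
  omega

theorem IsProjection.unique {X Y Y' : C.Ob} {e : X ⟶ Y} {e' : X ⟶ Y'} (he : C.IsProjection e)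
    (he' : C.IsProjection e') : Y = Y' ∧ e ≍ e' := by
  cases he
  cases he'
  exact ⟨rfl, HEq.rfl⟩

theorem projections_unique {X Y Y' : C.projections} (e : X ⟶ Y) (e' : X ⟶ Y') :
    Y = Y' ∧ e ≍ e' := by
  obtain ⟨h1, h2⟩ := IsProjection.unique e.2 e'.2
  have h3 : Y = Y' := h1
  subst h3
  exact ⟨rfl, heq_of_eq (Subtype.ext (eq_of_heq h2))⟩

theorem paths_unique {X Y Y' : C.projections} (a : Quiver.Path X Y) (b : Quiver.Path X Y')
    (h : C.len Y = C.len Y') : Y = Y' ∧ a ≍ b :=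
  Quiver.Path.heq_of_length (V := C.projections) C.len
    (fun {X Y : C.projections} (e : X ⟶ Y) => IsProjection.len_eq e.2) projections_unique a b h

theorem path_eq {X Y : C.projections} (a b : Quiver.Path X Y) : a = b :=
  eq_of_heq (paths_unique a b rfl).2

/-- The domain of the chosen pullback of a canonical projection `e` along `f`. -/
def IsProjection.pb {X Γ Δ : C.Ob} {e : X ⟶ Γ} (he : C.IsProjection e) (f : Δ ⟶ Γ) : C.Ob :=
  C.pb he.pos (f ≫ eqToHom he.ft_eq.symm)

/-- The top arrow of the chosen pullback of a canonical projection `e` along `f`. -/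
def IsProjection.q {X Γ Δ : C.Ob} {e : X ⟶ Γ} (he : C.IsProjection e) (f : Δ ⟶ Γ) : he.pb f ⟶ X :=
  C.q he.pos (f ≫ eqToHom he.ft_eq.symm)

/-- The canonical projection from the chosen pullback of a canonical projection. -/
def IsProjection.proj {X Γ Δ : C.Ob} {e : X ⟶ Γ} (he : C.IsProjection e) (f : Δ ⟶ Γ) :
    he.pb f ⟶ Δ :=
  C.p (he.pb f) (C.len_pb _ _) ≫ eqToHom (C.ft_pb _ _)

theorem IsProjection.isProjection_proj {X Γ Δ : C.Ob} {e : X ⟶ Γ} (he : C.IsProjection e)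
    (f : Δ ⟶ Γ) : C.IsProjection (he.proj f) :=
  IsProjection.mk' _ _

theorem IsProjection.isPullback {X Γ Δ : C.Ob} {e : X ⟶ Γ} (he : C.IsProjection e) (f : Δ ⟶ Γ) :
    IsPullback (he.q f) (he.proj f) e f := by
  cases he with
  | intro h =>
    have key : ∀ f' : Δ ⟶ C.ft X, f' = f → IsPullback (C.q h f')
        (C.p (C.pb h f') (C.len_pb h f') ≫ eqToHom (C.ft_pb h f')) (C.p X h) f := by
      rintro _ rfl
      exact C.isPullback h _
    exact key (f ≫ eqToHom rfl) (by simp)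

theorem IsProjection.pb_id {X Γ : C.Ob} {e : X ⟶ Γ} (he : C.IsProjection e) :
    he.pb (𝟙 Γ) = X ∧ he.q (𝟙 Γ) ≍ 𝟙 X := by
  cases he with
  | intro h =>
    exact ⟨(C.pb_congr _ h _ (𝟙 _) rfl rfl (by simp)).trans (C.pb_id h),
      (C.q_congr _ h _ (𝟙 _) rfl rfl (by simp)).trans (C.q_id h)⟩

theorem IsProjection.pb_comp {X Γ Δ Ξ : C.Ob} {e : X ⟶ Γ} (he : C.IsProjection e) (f : Δ ⟶ Γ)
    (g : Ξ ⟶ Δ) {e' : he.pb f ⟶ Δ} (he' : C.IsProjection e') :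
    he.pb (g ≫ f) = he'.pb g ∧ he.q (g ≫ f) ≍ he'.q g ≫ he.q f := by
  cases he with
  | intro h =>
    have h1 := (C.pb_congr h h ((g ≫ f) ≫ eqToHom rfl) (g ≫ (f ≫ eqToHom rfl)) rfl rfl
      (by simp)).trans (C.pb_comp h (f ≫ eqToHom rfl) g)
    have h2 := (C.q_congr h h ((g ≫ f) ≫ eqToHom rfl) (g ≫ (f ≫ eqToHom rfl)) rfl rfl
      (by simp)).trans (C.q_comp h (f ≫ eqToHom rfl) g)
    exact ⟨h1, h2⟩

/-- The pullback `f^* a` of a path `a : X → Γ` of canonical projections along an arrow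
`f : Δ ⟶ Γ`: it consists of an object, a path from it to `Δ`, and the arrow `π₂(f, a)` from it
to `X`. It is defined by induction on the length of `a`: the identity path pulls back to the
identity path, with `π₂(f, id) = f`, and otherwise one pulls back one projection at a time, using
the pullback squares of the C-system. The recursion starts at the target of `a`; starting at its
source gives the same pullbacks, by `pullPath_path_comp`. -/
def pullPath {X : C.projections} : ∀ {Γ : C.projections} (_ : Quiver.Path X Γ) {Δ : C.Ob}
    (_ : @Quiver.Hom C.Ob _ Δ Γ),
    Σ Y : C.Ob, @Quiver.Path C.projections _ Y Δ × @Quiver.Hom C.Ob _ Y X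
  | _, .nil, Δ, f => ⟨Δ, .nil, f⟩
  | _, .cons a e, _, f =>
    let r := pullPath a (IsProjection.q e.2 f)
    ⟨r.1, r.2.1.cons ⟨IsProjection.proj e.2 f, IsProjection.isProjection_proj e.2 f⟩, r.2.2⟩


theorem pullPath_congr {X Γ Γ' : C.projections} {a : Quiver.Path X Γ} {a' : Quiver.Path X Γ'}
    {Δ Δ' : C.Ob} {f : @Quiver.Hom C.Ob _ Δ Γ} {f' : @Quiver.Hom C.Ob _ Δ' Γ'} (hΓ : Γ = Γ')
    (hΔ : Δ = Δ') (ha : a ≍ a') (hf : f ≍ f') :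
    (pullPath a f).1 = (pullPath a' f').1 ∧ (pullPath a f).2.2 ≍ (pullPath a' f').2.2 := by
  subst hΓ hΔ
  cases ha
  cases hf
  exact ⟨rfl, HEq.rfl⟩

theorem pullPath_isPullback {X Γ : C.projections} (a : Quiver.Path X Γ) : ∀ {Δ : C.Ob}
    (f : @Quiver.Hom C.Ob _ Δ Γ),
    IsPullback (pullPath a f).2.2 (C.projections.composite (pullPath a f).2.1)
      (C.projections.composite a) f := by
  induction a with
  | nil => intro Δ f; exact IsPullback.id_vert f
  | cons a e ih => intro Δ f; exact (ih _).paste_vert (IsProjection.isPullback e.2 f)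

theorem pullPath_id {X Γ : C.projections} (a : Quiver.Path X Γ) :
    (pullPath a (@CategoryStruct.id C.Ob _ Γ)).1 = X ∧
      (pullPath a (@CategoryStruct.id C.Ob _ Γ)).2.2 ≍ @CategoryStruct.id C.Ob _ X := by
  induction a with
  | nil => exact ⟨rfl, HEq.rfl⟩
  | cons a e ih =>
    have h := IsProjection.pb_id e.2
    have h' := pullPath_congr (a := a) (a' := a) rfl h.1 HEq.rfl h.2
    exact ⟨h'.1.trans ih.1, h'.2.trans ih.2⟩

theorem comp_heq {D : Type*} [Category D] {X Y Z X' Y' Z' : D} {f : X ⟶ Y} {g : Y ⟶ Z}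
    {f' : X' ⟶ Y'} {g' : Y' ⟶ Z'} (hX : X = X') (hY : Y = Y') (hZ : Z = Z') (hf : f ≍ f')
    (hg : g ≍ g') : f ≫ g ≍ f' ≫ g' := by
  subst hX hY hZ; cases hf; cases hg; rfl

theorem pullPath_comp {X Γ : C.projections} (a : Quiver.Path X Γ) : ∀ {Δ Ξ : C.Ob}
    (f : @Quiver.Hom C.Ob _ Δ Γ) (g : Ξ ⟶ Δ),
    (pullPath a (g ≫ f)).1 = (pullPath (pullPath a f).2.1 g).1 ∧
      (pullPath a (g ≫ f)).2.2 ≍ (pullPath (pullPath a f).2.1 g).2.2 ≫ (pullPath a f).2.2 := by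
  induction a with
  | nil => intro Δ Ξ f g; exact ⟨rfl, HEq.rfl⟩
  | cons a e ih =>
    intro Δ Ξ f g
    have h := IsProjection.pb_comp e.2 f g (IsProjection.isProjection_proj e.2 f)
    have h' := pullPath_congr (a := a) (a' := a) rfl h.1 HEq.rfl h.2
    have h'' := ih (IsProjection.q e.2 f) (IsProjection.q (IsProjection.isProjection_proj e.2 f) g)
    exact ⟨h'.1.trans h''.1, h'.2.trans h''.2⟩

theorem pullPath_path_comp {Y X Γ : C.projections} (b : Quiver.Path Y X) (a : Quiver.Path X Γ) :
    ∀ {Δ : C.Ob} (f : @Quiver.Hom C.Ob _ Δ Γ),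
    (pullPath (b.comp a) f).1 = (pullPath b (pullPath a f).2.2).1 ∧
      (pullPath (b.comp a) f).2.2 ≍ (pullPath b (pullPath a f).2.2).2.2 := by
  induction a with
  | nil => intro Δ f; exact ⟨rfl, HEq.rfl⟩
  | cons a e ih => intro Δ f; exact ih (IsProjection.q e.2 f)

theorem exists_path_one (C : CSystem.{u}) : ∀ (n : ℕ) (X : C.Ob), C.len X = n →
    Nonempty (@Quiver.Path C.projections _ X C.one)
  | 0, X, h => by
    obtain rfl := (C.len_eq_zero_iff X).1 h
    exact ⟨.nil⟩
  | n + 1, X, h => by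
    have hX : 0 < C.len X := by omega
    obtain ⟨a⟩ := exists_path_one C n (C.ft X) (by rw [C.len_ft X hX, h]; rfl)
    exact ⟨(Quiver.Path.cons .nil (⟨C.p X hX, .intro X hX⟩ :
      @Quiver.Hom C.projections _ X (C.ft X))).comp a⟩

theorem composite_comp {D : Type*} [Category D] (H : WideSubquiver D) {X Y Z : H}
    (a : Quiver.Path X Y) (b : Quiver.Path Y Z) :
    H.composite (a.comp b) = H.composite a ≫ H.composite b := by
  simp [WideSubquiver.composite]

theorem len_path {X Y : C.projections} (a : Quiver.Path X Y) :
    C.len X = C.len Y + a.length := by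
  induction a with
  | nil => rfl
  | cons a e ih => rw [ih, IsProjection.len_eq e.2, Quiver.Path.length_cons]; omega

theorem length_pullPath {X Γ : C.projections} (a : Quiver.Path X Γ) : ∀ {Δ : C.Ob}
    (f : @Quiver.Hom C.Ob _ Δ Γ), (pullPath a f).2.1.length = a.length := by
  induction a with
  | nil => intro Δ f; rfl
  | cons a e ih => intro Δ f; exact congrArg (· + 1) (ih _)

/-- The two strict category structures and the functor `I` of the CE-system of a C-system. -/
def toCEBase (C : CSystem.{u}) : CEBase.{u} where
  Ob := C.Ob
  famCategory := C.freeCategory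
  I {X Y} a := @WideSubquiver.composite C.Ob _ C.projections X Y a
  I_id _ := rfl
  I_comp a b := composite_comp C.projections a b

theorem fam_eq {X Y : C.toCEBase.Fam} (a b : X ⟶ Y) : a = b :=
  path_eq (C := C) (X := X) (Y := Y) a b

theorem slice_ext {Γ : C.toCEBase.Ob} {A B : C.toCEBase.Slice Γ}
    (h : C.toCEBase.ext A = C.toCEBase.ext B) : A = B := by
  obtain ⟨X, ⟨⟨⟩⟩, a⟩ := A
  obtain ⟨Y, ⟨⟨⟩⟩, b⟩ := B
  have h' : X = Y := h
  subst h'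
  have : a = b := path_eq (C := C) (X := X) (Y := Γ) a b
  subst this
  rfl

/-- The CE-system of a C-system: its families are the paths of canonical projections. -/
def toCESystem (C : CSystem.{u}) : CESystem.{u} where
  toCEBase := C.toCEBase
  root := C.one
  root_terminal := by
    have h : ∀ X : C.toCEBase.Fam, Nonempty (Unique (@Quiver.Hom C.toCEBase.Fam _ X C.one)) := by
      intro X
      obtain ⟨a⟩ := exists_path_one C _ X rfl
      exact ⟨⟨⟨a⟩, fun b => fam_eq _ _⟩⟩
    exact ⟨@IsTerminal.ofUnique C.toCEBase.Fam _ C.one (fun X => (h X).some)⟩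
  pb {Γ Δ} f A := @Over.mk C.toCEBase.Fam _ Δ _ (pullPath (X := A.left) (Γ := Γ) A.hom f).2.1
  π₂ {Γ Δ} f A := (pullPath (X := A.left) (Γ := Γ) A.hom f).2.2
  isPullback f A := pullPath_isPullback _ f
  pb_idFam f := rfl
  π₂_idFam f := HEq.rfl
  pb_id A := slice_ext (pullPath_id _).1
  π₂_id A := (pullPath_id _).2
  pb_comp f g A := slice_ext (pullPath_comp _ f g).1
  π₂_comp f g A := (pullPath_comp _ f g).2
  pb_compFam f A P := slice_ext (pullPath_path_comp _ _ f).1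
  π₂_compFam f A P := (pullPath_path_comp _ _ f).2

/-- The stratification of the category of families of the CE-system of a C-system. -/
def stratification (C : CSystem.{u}) : @Stratification C.toCESystem.Fam _ C.one where
  L X := C.len X
  anti {X Y} a := by
    have h := len_path (C := C) (X := X) (Y := Y) a
    omega
  eq_zero_iff X := C.len_eq_zero_iff X
  eq_iff {X Y} a := by
    constructor
    · intro h
      have h' := len_path (C := C) (X := X) (Y := Y) a
      exact ⟨Quiver.Path.eq_of_length_zero (V := C.projections) a (by omega),
        path_eq (C := C) (X := X) (Y := Y) _ _⟩
    · rintro ⟨h, -⟩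
      exact congrArg C.len h
  factor {X Y} f _ := by
    have hL : ∀ {X Y : individualArrows (C := C.toCESystem.Fam) (fun X => C.len X)},
      (X ⟶ Y) → C.len X = C.len Y + 1 := fun e => e.2
    refine existsUnique_of_exists_of_unique ?_ ?_
    · have key : ∀ {X Y : C.projections}, Quiver.Path X Y → Nonempty (@Quiver.Path
          (individualArrows (C := C.toCESystem.Fam) (fun X => C.len X)) _ X Y) := by
        intro X Y a
        induction a with
        | nil => exact ⟨.nil⟩
        | cons a e ih =>
          obtain ⟨b⟩ := ih
          exact ⟨@Quiver.Path.cons (individualArrows (C := C.toCESystem.Fam) (fun X => C.len X))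
            _ _ _ _ b ⟨@Quiver.Hom.toPath C.projections _ _ _ e, IsProjection.len_eq e.2⟩⟩
      obtain ⟨a⟩ := key (X := X) (Y := Y) f
      exact ⟨a, path_eq (C := C) (X := X) (Y := Y) _ _⟩
    · intro a b _ _
      refine eq_of_heq (Quiver.Path.heq_of_length
        (V := individualArrows (C := C.toCESystem.Fam) (fun X => C.len X)) C.len hL ?_ a b rfl).2
      intro X Y Y' e e'
      have h1 := hL e
      have h2 := hL e'
      obtain ⟨h3, h4⟩ := paths_unique (C := C) (X := X) (Y := Y) (Y' := Y') e.1 e'.1 (by omega)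
      have h5 : Y = Y' := h3
      subst h5
      exact ⟨rfl, heq_of_eq (Subtype.ext (eq_of_heq h4))⟩

/-- The stratified rooted CE-system of a C-system. -/
def toStratifiedRootedCESystem (C : CSystem.{u}) : StratifiedRootedCESystem.{u} where
  toCESystem := C.toCESystem
  rooted := C.one_terminal
  strat := C.stratification
  pb_strat {Γ Δ} f A := by
    have h1 := len_path (C := C) (X := A.left) (Y := Γ) A.hom
    have h2 := len_path (C := C) (pullPath (X := A.left) (Γ := Γ) A.hom f).2.1
    have h3 := length_pullPath (C := C) (X := A.left) (Γ := Γ) A.hom f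
    change C.len (pullPath (X := A.left) (Γ := Γ) A.hom f).1 - C.len Δ = C.len A.left - C.len Γ
    omega

variable {D : CSystem.{u}}

theorem IsProjection.map (F : Hom C D) {X Y : C.Ob} {e : X ⟶ Y} (he : C.IsProjection e) :
    D.IsProjection (F.functor.map e) := by
  cases he with
  | intro h =>
    have hX : 0 < D.len (F.functor.obj X) := (F.map_len X).symm ▸ h
    have key : ∀ (Z : D.Ob) (a : F.functor.obj X ⟶ Z), Z = D.ft (F.functor.obj X) →
        a ≍ D.p (F.functor.obj X) hX → D.IsProjection a := by
      rintro _ a rfl h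
      cases h
      exact .intro _ _
    exact key _ _ (F.map_ft X) (F.map_p X h)

theorem IsProjection.map_pb (F : Hom C D) {X Γ Δ : C.Ob} {e : X ⟶ Γ} (he : C.IsProjection e)
    (f : Δ ⟶ Γ) : F.functor.obj (he.pb f) = (he.map F).pb (F.functor.map f) ∧
      F.functor.map (he.q f) ≍ (he.map F).q (F.functor.map f) := by
  cases he with
  | intro h =>
    exact ⟨(F.map_pb h _).trans (D.pb_congr _ _ _ _ rfl rfl (by simp)),
      (F.map_q h _).trans (D.q_congr _ _ _ _ rfl rfl (by simp))⟩

/-- The action of a morphism of C-systems on canonical projections. -/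
def Hom.projections (F : Hom C D) : C.projections ⥤q D.projections where
  obj X := F.functor.obj X
  map e := ⟨F.functor.map e.1, IsProjection.map F e.2⟩

theorem map_composite (F : Hom C D) {X Y : C.projections} (a : Quiver.Path X Y) :
    F.functor.map (C.projections.composite a) =
      D.projections.composite (F.projections.mapPath a) := by
  induction a with
  | nil => exact F.functor.map_id _
  | cons a e ih =>
    exact (F.functor.map_comp (C.projections.composite a) e.1).trans
      (congrArg (· ≫ F.functor.map e.1) ih)

theorem map_pullPath (F : Hom C D) {X Γ : C.projections} (a : Quiver.Path X Γ) : ∀ {Δ : C.Ob}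
    (f : @Quiver.Hom C.Ob _ Δ Γ),
    F.functor.obj (pullPath a f).1 = (pullPath (F.projections.mapPath a) (F.functor.map f)).1 ∧
      F.functor.map (pullPath a f).2.2 ≍
        (pullPath (F.projections.mapPath a) (F.functor.map f)).2.2 := by
  induction a with
  | nil => intro Δ f; exact ⟨rfl, HEq.rfl⟩
  | cons a e ih =>
    intro Δ f
    have h := IsProjection.map_pb F e.2 f
    have h' := ih (IsProjection.q e.2 f)
    have h'' := pullPath_congr (a := F.projections.mapPath a) (a' := F.projections.mapPath a)
      rfl h.1 HEq.rfl h.2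
    exact ⟨h'.1.trans h''.1, h'.2.trans h''.2⟩

/-- The CE-homomorphism of a morphism of C-systems. -/
def Hom.toCESystemHom (F : Hom C D) : CESystem.Hom C.toCESystem D.toCESystem where
  ctx := F.functor
  fam {X Y} a := @Prefunctor.mapPath C.projections _ D.projections _ F.projections X Y a
  fam_id _ := rfl
  fam_comp {X Y Z} a b := @Prefunctor.mapPath_comp C.projections _ D.projections _ F.projections
    X Y a Z b
  comm {X Y} a := map_composite F (X := X) (Y := Y) a
  map_root := F.map_one
  map_pb f _ := slice_ext (map_pullPath F _ f).1
  map_π₂ f _ := (map_pullPath F _ f).2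

end CSystem

/-- The functor `CE` from C-systems to stratified rooted CE-systems. The category of families of
`CE C` is the free category on the graph of canonical projections of `C`, and its pullbacks are
defined inductively from those of `C`. -/
def CE : CSystem.{u} ⥤ StratifiedRootedCESystem.{u} where
  obj C := C.toStratifiedRootedCESystem
  map F := ⟨CSystem.Hom.toCESystemHom F, CSystem.Hom.map_len F⟩
  map_id _ := Subtype.ext (CESystem.Hom.ext rfl fun _ => heq_of_eq (CSystem.fam_eq _ _))
  map_comp _ _ := Subtype.ext (CESystem.Hom.ext rfl fun _ => heq_of_eq (CSystem.fam_eq _ _))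

/-!
In a stratified category with terminal object `1`, an arrow out of `X` is determined by the length
of its target: continue it by the arrow to `1`; the factorization of `X → 1` into arrows of length
one is unique, and the given arrow is the composite of an initial segment of it
(`Stratification.arrow_unique`). So in the category of families of a stratified CE-system every
object `X` other than `1` has exactly one arrow of length one out of it, `X → ft X`, and any two
parallel families are equal. Equations between families over the same base therefore reduce to
equations between their domains.

The functor `CE` is faithful because a morphism of C-systems is a functor with properties. It is
full because a stratified CE-homomorphism maps a family of length one to a family of length one,
that is, a canonical projection to a canonical projection; its compatibility with the pullbacks of
these families is the compatibility with `f^* Γ` and `q(f, Γ)` (`CSystem.exists_hom`).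

It is essentially surjective because a stratified rooted CE-system `A` yields a C-system with the
same objects and arrows, whose canonical projections are the arrows `I (X → ft X)` and whose chosen
squares are the pullbacks of the families `X → ft X` (`StratifiedRootedCESystem.toCSystem`); they
lie over the canonical projections because pulling back preserves length. Every family of `A` is a
path of such projections, and compatibility of the pullbacks of `A` with composition shows that
they are the ones defined by induction along paths (`StratifiedRootedCESystem.pullPath_eq`). So `A`
is isomorphic to the CE-system of this C-system, by two homomorphisms which are the identity on
objects and on the arrows of the second category.
-/

/-! ### Arrows in a stratified category -/

/-- If two paths have the same composite path, initial segments with remainders of equal length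
coincide. -/
theorem Quiver.Path.left_unique_of_comp_eq {V : Type*} [Quiver V] {X Y Y' Z : V}
    (a : Quiver.Path X Y) (a' : Quiver.Path X Y') (b : Quiver.Path Y Z) : ∀ (b' : Quiver.Path Y' Z),
    b.length = b'.length → a.comp b = a'.comp b' → Y = Y' ∧ a ≍ a' := by
  induction b with
  | nil =>
    intro b' hl h
    cases b' with
    | nil => exact ⟨rfl, heq_of_eq h⟩
    | cons b' e' => simp at hl
  | cons b e ih =>
    intro b' hl h
    cases b' with
    | nil => simp at hl
    | cons b' e' =>
      rw [Quiver.Path.comp_cons, Quiver.Path.comp_cons] at h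
      obtain rfl := Quiver.Path.obj_eq_of_cons_eq_cons h
      exact ih b' (by simpa using hl) (eq_of_heq (Quiver.Path.heq_of_cons_eq_cons h))

namespace Stratification

variable {C : Type*} [Category C] {one : C} (S : Stratification C one)

theorem L_path {X Y : individualArrows S.L} (a : Quiver.Path X Y) :
    S.L X = S.L Y + a.length := by
  induction a with
  | nil => rfl
  | cons a e ih =>
    have h : S.L _ = S.L _ + 1 := e.2
    rw [ih, h, Quiver.Path.length_cons]
    omega

theorem exists_path {X Y : C} (f : X ⟶ Y) :
    ∃ a : @Quiver.Path (individualArrows S.L) _ X Y, (individualArrows S.L).composite a = f := by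
  rcases (S.anti f).lt_or_eq with h | h
  · exact (S.factor f h).exists
  · obtain ⟨rfl, rfl⟩ := (S.eq_iff f).1 h.symm
    exact ⟨.nil, rfl⟩

theorem path_ext {X Y : individualArrows S.L} (a b : Quiver.Path X Y)
    (h : (individualArrows S.L).composite a = (individualArrows S.L).composite b) : a = b := by
  have ha := S.L_path a
  have hb := S.L_path b
  rcases Nat.eq_zero_or_pos a.length with h0 | h0
  · cases a with
    | nil => exact (Quiver.Path.eq_nil_of_length_zero b (by omega)).symm
    | cons a e => simp at h0
  · exact (S.factor (X := X) (Y := Y) _ (by omega)).unique h rfl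

/-- In a stratified category an arrow is determined by its source and the length of its target:
followed by the arrow from its target to the terminal object, it gives the arrow from the source to
the terminal object, whose only path of arrows of length one has the given arrow as an initial
segment. -/
theorem arrow_unique (ht : IsTerminal one) {X Y Y' : C} (f : X ⟶ Y) (f' : X ⟶ Y')
    (h : S.L Y = S.L Y') : Y = Y' ∧ f ≍ f' := by
  obtain ⟨a, rfl⟩ := S.exists_path f
  obtain ⟨a', rfl⟩ := S.exists_path f'
  obtain ⟨b, -⟩ := S.exists_path (ht.from Y)
  obtain ⟨b', -⟩ := S.exists_path (ht.from Y')
  have hb := S.L_path b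
  have hb' := S.L_path b'
  obtain ⟨h1, h2⟩ := Quiver.Path.left_unique_of_comp_eq a a' b b' (by omega)
    (S.path_ext _ _ (ht.hom_ext _ _))
  have h1' : Y = Y' := h1
  subst h1'
  cases h2
  exact ⟨rfl, HEq.rfl⟩

/-- The arrow can be taken to be the first one of the path. -/
theorem exists_individual {X Y : individualArrows S.L} (a : Quiver.Path X Y)
    (h : S.L Y < S.L X) : ∃ Z : C, S.L X = S.L Z + 1 ∧ Nonempty (@Quiver.Hom C _ X Z) := by
  induction a with
  | nil => exact absurd h (lt_irrefl _)
  | @cons Y Z a e ih =>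
    by_cases h' : S.L Y < S.L X
    · exact ih h'
    · cases a with
      | nil => exact ⟨Z, e.2, ⟨e.1⟩⟩
      | cons a e' =>
        have h1 := S.L_path (a.cons e')
        rw [Quiver.Path.length_cons] at h1
        omega

/-- Every object of positive length has an arrow of length one out of it. For `X` of
length zero, the truncated subtraction makes `X` itself a witness. -/
theorem exists_father (ht : IsTerminal one) (X : C) :
    ∃ Y : C, S.L Y = S.L X - 1 ∧ Nonempty (X ⟶ Y) := by
  rcases Nat.eq_zero_or_pos (S.L X) with h0 | h0
  · exact ⟨X, by omega, ⟨𝟙 X⟩⟩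
  · obtain ⟨a, -⟩ := S.exists_path (ht.from X)
    have h1 : S.L one = 0 := (S.eq_zero_iff one).2 rfl
    obtain ⟨Y, hY, hf⟩ := S.exists_individual a (h1.trans_lt h0)
    exact ⟨Y, by omega, hf⟩

end Stratification

/-! ### Full faithfulness -/

namespace CSystem

variable {C D : CSystem.{u}}

/-- The canonical projection of `Γ`, as a family over `ft Γ` in the CE-system of `C`. -/
def projSlice (C : CSystem.{u}) (Γ : C.Ob) (h : 0 < C.len Γ) : C.toCESystem.Slice (C.ft Γ) :=
  @Over.mk C.toCEBase.Fam _ (C.ft Γ) Γ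
    (@Quiver.Hom.toPath C.projections _ Γ (C.ft Γ) ⟨C.p Γ h, .intro Γ h⟩)

theorem pb_projSlice {Γ Δ : C.Ob} (h : 0 < C.len Γ) (f : Δ ⟶ C.ft Γ) :
    C.toCESystem.ext (C.toCESystem.pb f (C.projSlice Γ h)) = C.pb h f ∧
      C.toCESystem.π₂ f (C.projSlice Γ h) ≍ C.q h f :=
  ⟨C.pb_congr _ _ _ _ rfl rfl (by simp), C.q_congr _ _ _ _ rfl rfl (by simp)⟩

theorem I_projSlice (Γ : C.Ob) (h : 0 < C.len Γ) :
    C.toCESystem.I (C.projSlice Γ h).hom = C.p Γ h :=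
  Category.id_comp (C.p Γ h)

/-- A family whose domain is longer by one than its base is the canonical projection of its
domain. -/
theorem eq_ft_of_fam {Γ X : C.toCEBase.Fam} (a : X ⟶ Γ) (h : C.len X = C.len Γ + 1) :
    Γ = C.ft X := by
  have hX : 0 < C.len X := by omega
  have hl := C.len_ft X hX
  exact (paths_unique (C := C) (X := X) (Y := Γ) (Y' := C.ft X) a
    (C.projSlice X hX).hom (by omega)).1

theorem I_fam_heq {Γ X : C.toCEBase.Fam} (a : X ⟶ Γ) (hX : 0 < C.len X) (hΓ : Γ = C.ft X) :
    C.toCESystem.I a ≍ C.p X hX := by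
  subst hΓ
  obtain rfl : a = (C.projSlice X hX).hom := fam_eq _ _
  exact heq_of_eq (I_projSlice X hX)

theorem pb_fam {Γ X : C.toCEBase.Fam} {Δ : C.Ob} (a : X ⟶ Γ) (hX : 0 < C.len X)
    (hΓ : Γ = C.ft X) (f : @Quiver.Hom C.Ob _ Δ Γ) :
    C.toCESystem.ext (C.toCESystem.pb f (Over.mk a)) = C.pb hX (f ≫ eqToHom hΓ) ∧
      C.toCESystem.π₂ f (Over.mk a) ≍ C.q hX (f ≫ eqToHom hΓ) := by
  subst hΓ
  obtain rfl : a = (C.projSlice X hX).hom := fam_eq _ _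
  have h1 := pb_projSlice hX f
  exact ⟨h1.1.trans (C.pb_congr _ _ _ _ rfl rfl (by simp)),
    h1.2.trans (C.q_congr _ _ _ _ rfl rfl (by simp))⟩

/-- A stratified CE-homomorphism between the CE-systems of two C-systems maps canonical projections
to canonical projections, hence comes from a morphism of C-systems. -/
theorem exists_hom (F : CESystem.Hom C.toCESystem D.toCESystem)
    (hF : ∀ X : C.Ob, D.len (F.ctx.obj X) = C.len X) :
    ∃ G : Hom C D, G.functor = F.ctx := by
  have hft : ∀ Γ (_ : 0 < C.len Γ), F.ctx.obj (C.ft Γ) = D.ft (F.ctx.obj Γ) := by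
    intro Γ h
    refine eq_ft_of_fam (C := D) (F.fam (C.projSlice Γ h).hom) ?_
    have h1 := hF Γ
    have h2 := hF (C.ft Γ)
    have h3 := C.len_ft Γ h
    change D.len (F.ctx.obj Γ) = D.len (F.ctx.obj (C.ft Γ)) + 1
    omega
  refine ⟨{ functor := F.ctx, map_one := F.map_root, map_len := hF, map_ft := ?_, map_p := ?_,
            map_pb := ?_, map_q := ?_ }, rfl⟩
  · intro Γ
    rcases Nat.eq_zero_or_pos (C.len Γ) with h | h
    · obtain rfl := (C.len_eq_zero_iff Γ).1 h
      have h1 : F.ctx.obj C.one = D.one := F.map_root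
      rw [C.ft_one, h1, D.ft_one]
    · exact hft Γ h
  · intro Γ h
    have h1 := I_fam_heq (C := D) (F.fam (C.projSlice Γ h).hom) ((hF Γ).symm ▸ h) (hft Γ h)
    have h2 := (congrArg F.ctx.map (I_projSlice Γ h)).symm.trans (F.comm (C.projSlice Γ h).hom)
    exact (heq_of_eq h2).trans h1
  · intro Γ Δ h f
    have h1 := pb_fam (C := D) (F.fam (C.projSlice Γ h).hom) ((hF Γ).symm ▸ h) (hft Γ h)
      (F.ctx.map f)
    have h2 := congrArg D.toCESystem.ext (F.map_pb f (C.projSlice Γ h))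
    exact (congrArg F.ctx.obj (pb_projSlice h f).1).symm.trans (h2.trans h1.1)
  · intro Γ Δ h f
    have h1 := pb_fam (C := D) (F.fam (C.projSlice Γ h).hom) ((hF Γ).symm ▸ h) (hft Γ h)
      (F.ctx.map f)
    have h2 := pb_projSlice h f
    exact ((functor_map_heq F.ctx h2.1 rfl h2.2).symm.trans (F.map_π₂ f (C.projSlice Γ h))).trans
      h1.2

end CSystem

instance CE_faithful : CE.{u}.Faithful where
  map_injective h := CSystem.Hom.ext (congrArg (fun F => CESystem.Hom.ctx F.1) h)

instance CE_full : CE.{u}.Full where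
  map_surjective {C D} F := by
    obtain ⟨G, hG⟩ := CSystem.exists_hom (C := C) (D := D) F.1 F.2
    exact ⟨G, Subtype.ext (CESystem.Hom.ext hG fun {X Y} a => by
      have key : ∀ (X Y X' Y' : D.toCEBase.Fam) (b : X ⟶ Y) (b' : X' ⟶ Y'), X = X' → Y = Y' →
          b ≍ b' := by
        rintro X Y _ _ b b' rfl rfl
        exact heq_of_eq (CSystem.fam_eq _ _)
      exact key _ _ _ _ _ _ (Functor.congr_obj hG X) (Functor.congr_obj hG Y))⟩

/-! ### The C-system of a stratified rooted CE-system -/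

namespace StratifiedRootedCESystem

variable (A : StratifiedRootedCESystem.{u})

variable {A} in
theorem fam_unique {X Y Y' : A.Fam} (a : X ⟶ Y) (a' : X ⟶ Y') (h : A.strat.L Y = A.strat.L Y') :
    Y = Y' ∧ a ≍ a' :=
  A.strat.arrow_unique A.root_terminal.some a a' h

variable {A} in
theorem fam_eq {X Y : A.Fam} (a b : X ⟶ Y) : a = b :=
  eq_of_heq (fam_unique a b rfl).2

variable {A} in
theorem slice_ext {Γ : A.Ob} {S T : A.Slice Γ} (h : A.ext S = A.ext T) : S = T := by
  obtain ⟨X, ⟨⟨⟩⟩, a⟩ := S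
  obtain ⟨Y, ⟨⟨⟩⟩, b⟩ := T
  have h' : X = Y := h
  subst h'
  obtain rfl : a = b := fam_eq (X := X) a b
  rfl

/-- The father of `X`: the target of the arrow of length one out of `X` in the category of
families, and `X` itself if `X` is the chosen object. -/
noncomputable def ft (X : A.Ob) : A.Ob :=
  (A.strat.exists_father A.root_terminal.some X).choose

theorem L_ft (X : A.Ob) : A.strat.L (A.ft X) = A.strat.L X - 1 :=
  (A.strat.exists_father A.root_terminal.some X).choose_spec.1

/-- The family `X → ft X`. -/
noncomputable def proj (X : A.Ob) : A.Slice (A.ft X) :=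
  @Over.mk A.Fam _ (A.ft X) X
    (A.strat.exists_father A.root_terminal.some X).choose_spec.2.some

variable {A} in
/-- A family whose domain is longer by one than its base is the projection of its domain. -/
theorem fam_eq_proj {X Γ : A.Fam} (a : X ⟶ Γ) (h : A.strat.L X = A.strat.L Γ + 1) :
    ∃ hΓ : A.ft X = Γ, A.I (A.proj X).hom ≫ eqToHom hΓ = A.I a := by
  have h1 := A.L_ft X
  obtain ⟨h2, h3⟩ := fam_unique (A.proj X).hom a (h1.trans (by omega))
  have h4 : A.ft X = Γ := h2
  subst h4
  obtain rfl := eq_of_heq h3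
  exact ⟨rfl, Category.comp_id _⟩

variable {A} in
theorem pb_congr {Γ Γ' Δ Δ' : A.Ob} {S : A.Slice Γ} {S' : A.Slice Γ'} {f : Δ ⟶ Γ}
    {f' : Δ' ⟶ Γ'} (hΓ : Γ = Γ') (hΔ : Δ = Δ') (hS : A.ext S = A.ext S') (hf : f ≍ f') :
    A.ext (A.pb f S) = A.ext (A.pb f' S') ∧ A.π₂ f S ≍ A.π₂ f' S' := by
  subst hΓ hΔ
  obtain rfl := slice_ext hS
  cases hf
  exact ⟨rfl, HEq.rfl⟩

variable {A} in
theorem L_pb_proj {Γ Δ : A.Ob} (h : 0 < A.strat.L Γ) (f : Δ ⟶ A.ft Γ) :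
    A.strat.L (A.ext (A.pb f (A.proj Γ))) = A.strat.L Δ + 1 := by
  have h1 : A.strat.L (A.ext (A.pb f (A.proj Γ))) - A.strat.L Δ =
    A.strat.L Γ - A.strat.L (A.ft Γ) := A.pb_strat f (A.proj Γ)
  have h2 := A.L_ft Γ
  omega

/-- The C-system of a stratified rooted CE-system, with the same category, whose canonical
projections are the families of length one. -/
noncomputable def toCSystem : CSystem.{u} where
  Ob := A.Ob
  len := A.strat.L
  one := A.root
  ft := A.ft
  p Γ _ := A.I (A.proj Γ).hom
  pb {Γ _} _ f := A.ext (A.pb f (A.proj Γ))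
  q {Γ _} _ f := A.π₂ f (A.proj Γ)
  len_eq_zero_iff := A.strat.eq_zero_iff
  len_ft Γ _ := A.L_ft Γ
  ft_one := by
    have h1 : A.strat.L A.root = 0 := (A.strat.eq_zero_iff _).2 rfl
    exact (A.strat.eq_zero_iff _).1 (by rw [A.L_ft, h1])
  one_terminal := A.rooted
  len_pb h f := by
    rw [L_pb_proj h f]
    exact Nat.succ_pos _
  ft_pb {Γ _} h f := (fam_eq_proj (A.pb f (A.proj Γ)).hom (L_pb_proj h f)).1
  isPullback {Γ _} h f := by
    have h1 := A.isPullback f (A.proj Γ)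
    rw [← (fam_eq_proj (A.pb f (A.proj Γ)).hom (L_pb_proj h f)).2] at h1
    exact h1
  pb_id {Γ} _ := congrArg A.ext (A.pb_id (A.proj Γ))
  q_id {Γ} _ := A.π₂_id (A.proj Γ)
  pb_comp {Γ Δ Ε} h g f :=
    (congrArg A.ext (A.pb_comp g f (A.proj Γ))).trans
      (pb_congr (fam_eq_proj (A.pb g (A.proj Γ)).hom (L_pb_proj h g)).1.symm rfl rfl
        (by simp)).1
  q_comp {Γ Δ Ε} h g f := by
    have h1 := pb_congr (S := A.pb g (A.proj Γ)) (S' := A.proj _) (f := f)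
      (f' := f ≫ eqToHom (fam_eq_proj (A.pb g (A.proj Γ)).hom (L_pb_proj h g)).1.symm)
      (fam_eq_proj (A.pb g (A.proj Γ)).hom (L_pb_proj h g)).1.symm rfl rfl (by simp)
    exact (A.π₂_comp g f (A.proj Γ)).trans (CSystem.comp_heq h1.1 rfl rfl h1.2 HEq.rfl)

/-! ### Essential surjectivity -/

/-- The composite of a path of canonical projections comes from a family. -/
theorem exists_fam_path {X Y : A.toCSystem.projections} (a : Quiver.Path X Y) :
    ∃ b : @Quiver.Hom A.Fam _ X Y, A.I b = A.toCSystem.projections.composite a := by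
  induction a with
  | nil => exact ⟨@CategoryStruct.id A.Fam _ X, A.I_id X⟩
  | @cons Y Z a e ih =>
    obtain ⟨b, hb⟩ := ih
    obtain ⟨e, he⟩ := e
    cases he with
    | intro h =>
      refine ⟨@CategoryStruct.comp A.Fam _ _ _ _ b (A.proj Y).hom, ?_⟩
      exact (A.I_comp b (A.proj Y).hom).trans (congrArg (· ≫ A.I (A.proj Y).hom) hb)

/-- Families of length one are canonical projections, so the factorization of a family into families
of length one is a path of canonical projections. -/
theorem exists_path_of_path {X Y : individualArrows A.strat.L} (a : Quiver.Path X Y) :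
    Nonempty (@Quiver.Path A.toCSystem.projections _ X Y) := by
  induction a with
  | nil => exact ⟨.nil⟩
  | @cons Y Z a e ih =>
    obtain ⟨c⟩ := ih
    obtain ⟨hZ, he⟩ := fam_eq_proj (X := Y) (Γ := Z) e.1 e.2
    have hY : A.strat.L Y = A.strat.L Z + 1 := e.2
    have hp : A.toCSystem.IsProjection (X := Y) (Y := Z) (A.I (A.proj Y).hom ≫ eqToHom hZ) :=
      CSystem.IsProjection.mk' (C := A.toCSystem) (X := Y) ((Nat.succ_pos _).trans_eq hY.symm) hZ
    exact ⟨c.cons ⟨_, hp⟩⟩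

theorem exists_path_of_fam {X Y : A.Fam} (b : X ⟶ Y) :
    Nonempty (@Quiver.Path A.toCSystem.projections _ X Y) :=
  A.exists_path_of_path (A.strat.exists_path b).choose

/-- The inductively defined pullbacks in the CE-system of the C-system of `A` are those of `A`. The
induction uses the compatibility of the pullbacks of `A` with composition of families. -/
theorem pullPath_eq {X Γ : A.toCSystem.projections} (a : Quiver.Path X Γ) : ∀ {Δ : A.Ob}
    (b : @Quiver.Hom A.Fam _ X Γ) (f : @Quiver.Hom A.Ob _ Δ Γ),
    (CSystem.pullPath a f).1 = A.ext (A.pb f (Over.mk b)) ∧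
      (CSystem.pullPath a f).2.2 ≍ A.π₂ f (Over.mk b) := by
  induction a with
  | nil =>
    intro Δ b f
    obtain rfl : b = @CategoryStruct.id A.Fam _ X := fam_eq _ _
    exact ⟨(congrArg A.ext (A.pb_idFam f)).symm, (A.π₂_idFam f).symm⟩
  | @cons Y Z a e ih =>
    intro Δ b f
    obtain ⟨e, he⟩ := e
    cases he with
    | intro h =>
      obtain ⟨b', -⟩ := A.exists_fam_path a
      obtain rfl : b = @CategoryStruct.comp A.Fam _ _ _ _ b' (A.proj Y).hom := fam_eq _ _
      have h1 : A.ext (A.pb (f ≫ eqToHom rfl) (A.proj Y)) = A.ext (A.pb f (A.proj Y)) ∧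
          A.π₂ (f ≫ eqToHom rfl) (A.proj Y) ≍ A.π₂ f (A.proj Y) :=
        pb_congr rfl rfl rfl (heq_of_eq (Category.comp_id f))
      have h2 := CSystem.pullPath_congr (C := A.toCSystem) (a := a) (a' := a) rfl h1.1 HEq.rfl h1.2
      have h3 := ih b' (A.π₂ f (A.proj Y))
      exact ⟨(h2.1.trans h3.1).trans (congrArg A.ext (A.pb_compFam f (A.proj Y) (Over.mk b'))).symm,
        (h2.2.trans h3.2).trans (A.π₂_compFam f (A.proj Y) (Over.mk b')).symm⟩

/-- The comparison from the CE-system of the C-system of `A` to `A`. -/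
noncomputable def comparisonHom : CESystem.Hom A.toCSystem.toCESystem A.toCESystem where
  ctx := 𝟭 A.Ob
  fam {_ _} a := (A.exists_fam_path a).choose
  fam_id _ := fam_eq _ _
  fam_comp _ _ := fam_eq _ _
  comm a := (A.exists_fam_path a).choose_spec.symm
  map_root := rfl
  map_pb f _ := slice_ext (A.pullPath_eq _ _ f).1
  map_π₂ f _ := (A.pullPath_eq _ _ f).2

/-- The comparison from `A` to the CE-system of the C-system of `A`. -/
noncomputable def comparisonInv : CESystem.Hom A.toCESystem A.toCSystem.toCESystem where
  ctx := 𝟭 A.Ob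
  fam {_ _} b := (A.exists_path_of_fam b).some
  fam_id X := CSystem.fam_eq (C := A.toCSystem) (X := X) (Y := X) _ _
  fam_comp {X _ Z} _ _ := CSystem.fam_eq (C := A.toCSystem) (X := X) (Y := Z) _ _
  comm b := by
    obtain ⟨b', hb'⟩ := A.exists_fam_path (A.exists_path_of_fam b).some
    exact (congrArg A.I (fam_eq b b')).trans hb'
  map_root := rfl
  map_pb f X := CSystem.slice_ext (A.pullPath_eq _ X.hom f).1.symm
  map_π₂ f X := (A.pullPath_eq _ X.hom f).2.symm

/-- A stratified rooted CE-system is isomorphic to the CE-system of its C-system. -/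
noncomputable def comparisonIso : CE.{u}.obj A.toCSystem ≅ A where
  hom := ⟨A.comparisonHom, fun _ => rfl⟩
  inv := ⟨A.comparisonInv, fun _ => rfl⟩
  hom_inv_id := Subtype.ext (CESystem.Hom.ext rfl fun _ => heq_of_eq (CSystem.fam_eq _ _))
  inv_hom_id := Subtype.ext (CESystem.Hom.ext rfl fun {X Y} _ =>
    heq_of_eq (fam_eq (A := A) (X := X) (Y := Y) _ _))

end StratifiedRootedCESystem

instance CE_essSurj : CE.{u}.EssSurj where
  mem_essImage A := ⟨A.toCSystem, ⟨A.comparisonIso⟩⟩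

/-- The functor `CE` from the category of C-systems to the category of stratified rooted CE-systems
and stratified CE-homomorphisms is an equivalence of categories. -/
theorem mainTheorem2 : CE.{u}.IsEquivalence := by
  exact { faithful := CE_faithful, full := CE_full, essSurj := CE_essSurj }
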